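/- Let $(M,g)$ be a smooth Riemannian manifold of dimension $n>2$ with Levi-Civita connection $\nabla$. Let $\xi$ be a smooth vector field on $M$ with $g(\xi,\xi)=1$, and let $\pi$ be the $1$-form $\pi(X)=g(X,\xi)$. Let $\tilde\nabla$ be the projective semi-symmetric connection on $M$ determined by $\xi$, that is, $$\tilde\nabla_XY=\nabla_XY+\psi(Y)X+\psi(X)Y+\phi(Y)X-\phi(X)Y,\qquad \phi=\tfrac12\,\pi,\quad \psi=\tfrac{n-1}{2(n+1)}\,\pi .$$ Suppose that $\pi$ is parallel for $\nabla$ (equivalently, $\nabla\xi=0$), i.e. $(\nabla_X\pi)(Y)=X(\pi(Y))-\pi(\nabla_XY)=0$ for all smooth vector fields $X,Y$. For a linear connection $D$ let $R^D(X,Y)Z=D_XD_YZ-D_YD_XZ-D_{[X,Y]}Z$ be its curvature tensor, and write $R=R^{\nabla}$, $\tilde R=R^{\tilde\nabla}$. Then $M$ is semi-symmetric with respect to $\tilde\nabla$, in the sense that $\tilde R\cdot\tilde R=0$, i.e. $$(\tilde R(X,Y)\cdot\tilde R)(Z,W)U:=\tilde R(X,Y)\tilde R(Z,W)U-\tilde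 R(\tilde R(X,Y)Z,W)U-\tilde R(Z,\tilde R(X,Y)W)U-\tilde R(Z,W)\tilde R(X,Y)U=0$$ for all smooth vector fields $X,Y,Z,W,U$, if and only if $M$ is flat with respect to $\nabla$, i.e. $R(X,Y)Z=0$ for all smooth vector fields $X,Y,Z$. -/

import Mathlib

open Bundle
open scoped Manifold ContDiff

noncomputable section

namespace ProjSemiSymm

section Connection

variable {E : Type*} [NormedAddCommGroup E] [NormedSpace ℝ E]
  {M : Type*} [TopologicalSpace M] [ChartedSpace E M]

/-- Vector fields on the manifold `M` modelled on `E`, without regularity. -/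
abbrev VField (E M : Type*) [NormedAddCommGroup E] [NormedSpace ℝ E]
    [TopologicalSpace M] [ChartedSpace E M] : Type _ :=
  Π x : M, TangentSpace 𝓘(ℝ, E) x

variable [IsManifold 𝓘(ℝ, E) ∞ M]

/-- The vector field `X` is smooth, as a section of the tangent bundle. -/
def IsSmoothField (X : VField E M) : Prop :=
  ContMDiff 𝓘(ℝ, E) 𝓘(ℝ, E).tangent ∞ (fun x ↦ (⟨x, X x⟩ : TangentBundle 𝓘(ℝ, E) M))

/-- Linear connections on `M`, that is, covariant derivatives on its tangent bundle. -/
abbrev LinearConnection (E M : Type*) [NormedAddCommGroup E] [NormedSpace ℝ E]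
    [TopologicalSpace M] [ChartedSpace E M] [IsManifold 𝓘(ℝ, E) ∞ M] : Type _ :=
  CovariantDerivative 𝓘(ℝ, E) E (fun x : M ↦ TangentSpace 𝓘(ℝ, E) x)

/-- `∇_X Y`. -/
def covD (D : LinearConnection E M) (X Y : VField E M) : VField E M :=
  fun x ↦ D Y x (X x)

/-- The curvature `R(X, Y)Z = ∇_X ∇_Y Z - ∇_Y ∇_X Z - ∇_[X, Y] Z`. -/
def curvature (D : LinearConnection E M) (X Y Z : VField E M) : VField E M :=
  covD D X (covD D Y Z) - covD D Y (covD D X Z)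
    - covD D (VectorField.mlieBracket 𝓘(ℝ, E) X Y) Z

/-- The connection is flat: `R(X, Y)Z = 0` for all smooth vector fields. -/
def IsFlat (D : LinearConnection E M) : Prop :=
  ∀ X Y Z : VField E M, IsSmoothField X → IsSmoothField Y → IsSmoothField Z →
    curvature D X Y Z = 0

/-- `(R(X, Y) · R)(Z, W)U`, where `R(X, Y)` acts on the curvature tensor as a derivation. -/
def curvatureAction (D : LinearConnection E M) (X Y Z W U : VField E M) : VField E M :=
  curvature D X Y (curvature D Z W U) - curvature D (curvature D X Y Z) W U
    - curvature D Z (curvature D X Y W) U - curvature D Z W (curvature D X Y U)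

/-- Semi-symmetry with respect to a connection: `R · R = 0`. -/
def IsSemiSymmetric (D : LinearConnection E M) : Prop :=
  ∀ X Y Z W U : VField E M, IsSmoothField X → IsSmoothField Y → IsSmoothField Z →
    IsSmoothField W → IsSmoothField U → curvatureAction D X Y Z W U = 0

end Connection

section Riemannian

variable {E : Type*} [NormedAddCommGroup E] [NormedSpace ℝ E]
  {M : Type*} [TopologicalSpace M] [ChartedSpace E M] [IsManifold 𝓘(ℝ, E) ∞ M]
  [RiemannianBundle (fun x : M ↦ TangentSpace 𝓘(ℝ, E) x)]

/-- The `1`-form `π(X) = g(X, ξ)` associated with the vector field `ξ`. -/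
def assocForm (ξ : VField E M) (x : M) : TangentSpace 𝓘(ℝ, E) x →L[ℝ] ℝ :=
  innerSL ℝ (ξ x)

/-- The `1`-form `φ = (1 / 2) π`. -/
def phiForm (ξ : VField E M) (x : M) : TangentSpace 𝓘(ℝ, E) x →L[ℝ] ℝ :=
  (1 / 2 : ℝ) • assocForm ξ x

/-- The `1`-form `ψ = (n - 1) / (2 (n + 1)) π`, where `n` is the dimension of the manifold. -/
def psiForm (ξ : VField E M) (x : M) : TangentSpace 𝓘(ℝ, E) x →L[ℝ] ℝ :=
  (((Module.finrank ℝ E : ℝ) - 1) / (2 * ((Module.finrank ℝ E : ℝ) + 1))) • assocForm ξ x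

/-- The difference tensor, with the differentiated field `Y` as first argument:
`(Y, X) ↦ ψ(Y)X + ψ(X)Y + φ(Y)X - φ(X)Y`. -/
def differenceForm (ξ : VField E M) (x : M) :
    TangentSpace 𝓘(ℝ, E) x →L[ℝ] TangentSpace 𝓘(ℝ, E) x →L[ℝ] TangentSpace 𝓘(ℝ, E) x :=
  (psiForm ξ x + phiForm ξ x).smulRight (ContinuousLinearMap.id ℝ (TangentSpace 𝓘(ℝ, E) x))
    + ContinuousLinearMap.smulRightL ℝ (TangentSpace 𝓘(ℝ, E) x) (TangentSpace 𝓘(ℝ, E) x)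
        (psiForm ξ x - phiForm ξ x)

/-- The projective semi-symmetric connection
`∇̃_X Y = ∇_X Y + ψ(Y)X + ψ(X)Y + φ(Y)X - φ(X)Y`; see `covD_projSemiSymm`. -/
def projSemiSymm (D : LinearConnection E M) (ξ : VField E M) : LinearConnection E M :=
  D.addOneForm (differenceForm ξ)

theorem covD_projSemiSymm (D : LinearConnection E M) (ξ X Y : VField E M) (x : M) :
    covD (projSemiSymm D ξ) X Y x =
      covD D X Y x + psiForm ξ x (Y x) • X x + psiForm ξ x (X x) • Y x
        + phiForm ξ x (Y x) • X x - phiForm ξ x (X x) • Y x := by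
  change D Y x (X x) + ((psiForm ξ x (Y x) + phiForm ξ x (Y x)) • X x
    + (psiForm ξ x (X x) - phiForm ξ x (X x)) • Y x) = _
  simp only [covD]
  module

/-- The condition `(∇_X π)(Y) = X(π(Y)) - π(∇_X Y) = 0` for all smooth vector fields. -/
def IsParallelForm (D : LinearConnection E M) (ξ : VField E M) : Prop :=
  ∀ X Y : VField E M, IsSmoothField X → IsSmoothField Y → ∀ x : M,
    mvfderiv 𝓘(ℝ, E) (fun y ↦ assocForm ξ y (Y y)) x (X x) - assocForm ξ x (covD D X Y x) = 0

variable [FiniteDimensional ℝ E]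

/-- If `∇` is torsion-free, then `∇̃` has torsion `T(X, Y) = π(Y)X - π(X)Y`: it is semi-symmetric. -/
theorem torsion_projSemiSymm (D : LinearConnection E M) (hD : D.torsion = 0) (ξ : VField E M)
    (x : M) (u v : TangentSpace 𝓘(ℝ, E) x) :
    (projSemiSymm D ξ).torsion x u v = assocForm ξ x v • u - assocForm ξ x u • v := by
  have h := congr($hD x u v)
  rw [CovariantDerivative.torsion_apply_eq_extend] at h ⊢
  have e1 := covD_projSemiSymm D ξ (FiberBundle.extend E u) (FiberBundle.extend E v) x
  have e2 := covD_projSemiSymm D ξ (FiberBundle.extend E v) (FiberBundle.extend E u) x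
  simp only [covD] at e1 e2
  rw [e1, e2]
  simp only [FiberBundle.extend_apply_self, phiForm, psiForm] at h ⊢
  simp only [smul_apply, zero_apply, Pi.zero_apply, smul_eq_mul] at h ⊢
  rw [sub_eq_zero] at h
  rw [← h]
  module

variable [IsContMDiffRiemannianBundle 𝓘(ℝ, E) ∞ E (fun x : M ↦ TangentSpace 𝓘(ℝ, E) x)]

/-- The connection `D` is compatible with the metric, `∇g = 0`. The instance arguments are spelled
out because unification does not find them. -/
def IsMetric (D : LinearConnection E M) : Prop :=
  @CovariantDerivative.IsMetricCompatible E _ _ E _ 𝓘(ℝ, E) M _ _ E _ _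
    (fun x : M ↦ TangentSpace 𝓘(ℝ, E) x) _ (fun _ ↦ inferInstance) (fun _ ↦ inferInstance) _
    D _ _ _ _

theorem isMetric_iff (D : LinearConnection E M) :
    IsMetric D ↔ ∀ {x : M} {X Y Z : VField E M},
      MDifferentiableAt 𝓘(ℝ, E) 𝓘(ℝ, E).tangent (fun y ↦ (⟨y, X y⟩ : TangentBundle 𝓘(ℝ, E) M)) x →
      MDifferentiableAt 𝓘(ℝ, E) 𝓘(ℝ, E).tangent (fun y ↦ (⟨y, Y y⟩ : TangentBundle 𝓘(ℝ, E) M)) x →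
      MDifferentiableAt 𝓘(ℝ, E) 𝓘(ℝ, E).tangent (fun y ↦ (⟨y, Z y⟩ : TangentBundle 𝓘(ℝ, E) M)) x →
      mvfderiv 𝓘(ℝ, E) (fun y ↦ inner ℝ (Y y) (Z y)) x (X x) =
        inner ℝ (covD D X Y x) (Z x) + inner ℝ (Y x) (covD D X Z x) :=
  @CovariantDerivative.isMetricCompatible_iff E _ _ E _ 𝓘(ℝ, E) M _ _ E _ _
    (fun x : M ↦ TangentSpace 𝓘(ℝ, E) x) _ (fun _ ↦ inferInstance) (fun _ ↦ inferInstance) _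
    D _ _ _ _ _

/-- `D` is the Levi-Civita connection: smooth, torsion-free and metric. Mathlib's covariant
derivatives also take (irrelevant) values on nondifferentiable fields; on differentiable fields
these properties determine `D`. -/
structure IsLeviCivita (D : LinearConnection E M) : Prop where
  smooth : D.ContMDiffCovariantDerivative ∞
  torsionFree : D.torsion = 0
  metric : IsMetric D

end Riemannian

end ProjSemiSymm

end

open Bundle
open scoped Manifold ContDiff

namespace ProjSemiSymm

/-! ### Calculus of smooth fields, connections and brackets -/

section Smooth

variable {E : Type*} [NormedAddCommGroup E] [NormedSpace ℝ E]
  {M : Type*} [TopologicalSpace M] [ChartedSpace E M] [IsManifold 𝓘(ℝ, E) ∞ M]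

/-! Write c = n/(n+1) and B(X,Y)Z = π(Z)(π(Y)X - π(X)Y). Since π is parallel,
`curvature_projSemiSymm` gives R̃ = R + c²B. If R = 0, then R̃·R̃ = c⁴ B·B, which vanishes
identically because π∘B = 0. Conversely, parallelism gives π∘R = 0 (`assocFun_curvature`) and
R(X,Y)ξ = 0 (`curvature_parallel_eq_zero`). Hence (R̃(X,ξ)·R̃)(Z,W)ξ collapses to -c²R(Z,W)X
(`curvatureAction_projSemiSymm_self`), and c ≠ 0 forces R = 0. Curvature acts here on fields, so
functions must be pulled out of it by hand. Only coefficients π(W) occur, and they pass through R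
because π∘R = 0 (`curvature_assocFun_smul`). -/

theorem IsSmoothField.mdifferentiableAt {X : VField E M} (hX : IsSmoothField X) (x : M) :
    MDifferentiableAt 𝓘(ℝ, E) 𝓘(ℝ, E).tangent
      (fun y ↦ (⟨y, X y⟩ : TangentBundle 𝓘(ℝ, E) M)) x :=
  (hX x).mdifferentiableAt (by simp)

theorem IsSmoothField.add {X Y : VField E M} (hX : IsSmoothField X) (hY : IsSmoothField Y) :
    IsSmoothField (X + Y) :=
  ContMDiff.add_section hX hY

theorem IsSmoothField.sub {X Y : VField E M} (hX : IsSmoothField X) (hY : IsSmoothField Y) :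
    IsSmoothField (X - Y) :=
  ContMDiff.sub_section hX hY

theorem IsSmoothField.smul {f : M → ℝ} {X : VField E M} (hf : ContMDiff 𝓘(ℝ, E) 𝓘(ℝ, ℝ) ∞ f)
    (hX : IsSmoothField X) : IsSmoothField (f • X) :=
  ContMDiff.smul_section hf hX

theorem IsSmoothField.covD {D : LinearConnection E M} (hD : D.ContMDiffCovariantDerivative ∞)
    {X Y : VField E M} (hX : IsSmoothField X) (hY : IsSmoothField Y) :
    IsSmoothField (covD D X Y) := by
  have h := (hD.contMDiff.contMDiff (σ := Y) (by exact hY.contMDiffOn))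
  rw [contMDiffOn_univ] at h
  exact h.clm_bundle_apply hX

theorem IsSmoothField.mlieBracket [CompleteSpace E] {X Y : VField E M} (hX : IsSmoothField X)
    (hY : IsSmoothField Y) : IsSmoothField (VectorField.mlieBracket 𝓘(ℝ, E) X Y) :=
  have : IsManifold 𝓘(ℝ, E) (minSmoothness ℝ 2) M :=
    IsManifold.of_le (n := ∞) (by simp; exact ENat.LEInfty.out)
  have : IsManifold 𝓘(ℝ, E) ((⊤ : ℕ∞) + 1) M := by
    simpa using ‹IsManifold 𝓘(ℝ, E) ∞ M›
  ContDiff.mlieBracket_vectorField (m := ⊤) (n := ⊤) hX hY (by simp)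

theorem IsSmoothField.curvature [CompleteSpace E] {D : LinearConnection E M}
    (hD : D.ContMDiffCovariantDerivative ∞) {X Y Z : VField E M} (hX : IsSmoothField X) (hY : IsSmoothField Y) (hZ : IsSmoothField Z) :
    IsSmoothField (curvature D X Y Z) :=
  ((hX.covD hD (hY.covD hD hZ)).sub (hY.covD hD (hX.covD hD hZ))).sub
    ((hX.mlieBracket hY).covD hD hZ)

theorem covD_add (D : LinearConnection E M) (X : VField E M) {Y Z : VField E M}
    (hY : IsSmoothField Y) (hZ : IsSmoothField Z) :
    covD D X (Y + Z) = covD D X Y + covD D X Z := by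
  funext x
  exact congr($(D.isCovariantDerivativeOnUniv.add (hY.mdifferentiableAt x)
    (hZ.mdifferentiableAt x)) (X x))

theorem covD_smul (D : LinearConnection E M) (X : VField E M) {f : M → ℝ} {Y : VField E M}
    (hf : ContMDiff 𝓘(ℝ, E) 𝓘(ℝ, ℝ) ∞ f) (hY : IsSmoothField Y) :
    covD D X (f • Y) = f • covD D X Y + (fun x ↦ mvfderiv 𝓘(ℝ, E) f x (X x)) • Y := by
  funext x
  exact congr($(D.isCovariantDerivativeOnUniv.leibniz (hY.mdifferentiableAt x)
    ((hf x).mdifferentiableAt (by simp))) (X x))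

theorem covD_const_smul (D : LinearConnection E M) (X : VField E M) (c : ℝ) {Y : VField E M}
    (hY : IsSmoothField Y) : covD D X (c • Y) = c • covD D X Y := by
  funext x
  exact congr($(D.isCovariantDerivativeOnUniv.smul_const c (hY.mdifferentiableAt x)) (X x))

theorem mlieBracket_eq_covD_sub [FiniteDimensional ℝ E] {D : LinearConnection E M}
    (hD : D.torsion = 0) {X Y : VField E M} (hX : IsSmoothField X) (hY : IsSmoothField Y) :
    VectorField.mlieBracket 𝓘(ℝ, E) X Y = covD D X Y - covD D Y X :=
  have : CompleteSpace E := FiniteDimensional.complete ℝ E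
  funext fun x ↦ (D.torsion_eq_zero_iff.1 hD (hX.mdifferentiableAt x) (hY.mdifferentiableAt x)).symm

theorem curvature_sub {D : LinearConnection E M} (hD : D.ContMDiffCovariantDerivative ∞)
    {X Y Z W : VField E M} (hX : IsSmoothField X) (hY : IsSmoothField Y) (hZ : IsSmoothField Z) (hW : IsSmoothField W) :
    curvature D X Y (Z - W) = curvature D X Y Z - curvature D X Y W := by
  have h {U V V' : VField E M} (hV : IsSmoothField V) (hV' : IsSmoothField V') :
      covD D U (V - V') = covD D U V - covD D U V' := by
    rw [eq_sub_iff_add_eq, ← covD_add D U (hV.sub hV') hV', sub_add_cancel]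
  rw [curvature, h hZ hW, h hZ hW, h (hY.covD hD hZ) (hY.covD hD hW),
    h (hX.covD hD hZ) (hX.covD hD hW), h hZ hW, curvature, curvature]
  abel

theorem curvature_const_smul {D : LinearConnection E M}
    (hD : D.ContMDiffCovariantDerivative ∞) {X Y Z : VField E M} (hX : IsSmoothField X)
    (hY : IsSmoothField Y) (c : ℝ) (hZ : IsSmoothField Z) :
    curvature D X Y (c • Z) = c • curvature D X Y Z := by
  rw [curvature, covD_const_smul D _ c hZ, covD_const_smul D _ c hZ, covD_const_smul D _ c hZ,
    covD_const_smul D _ c (hY.covD hD hZ), covD_const_smul D _ c (hX.covD hD hZ), curvature,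
    smul_sub, smul_sub]

/-- Evaluating the Jacobi identity on `X`, `Y` and `f • V` shows that the Lie bracket acts on `f`
as the commutator, wherever some field `V` does not vanish. -/
theorem mvfderiv_mlieBracket [CompleteSpace E] {X Y V : VField E M} (hX : IsSmoothField X)
    (hY : IsSmoothField Y) (hV : IsSmoothField V) {f : M → ℝ}
    (hf : ContMDiff 𝓘(ℝ, E) 𝓘(ℝ, ℝ) ∞ f)
    (hXf : ContMDiff 𝓘(ℝ, E) 𝓘(ℝ, ℝ) ∞ fun x ↦ mvfderiv 𝓘(ℝ, E) f x (X x))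
    (hYf : ContMDiff 𝓘(ℝ, E) 𝓘(ℝ, ℝ) ∞ fun x ↦ mvfderiv 𝓘(ℝ, E) f x (Y x))
    {x : M} (hx : V x ≠ 0) :
    mvfderiv 𝓘(ℝ, E) f x (VectorField.mlieBracket 𝓘(ℝ, E) X Y x) =
      mvfderiv 𝓘(ℝ, E) (fun y ↦ mvfderiv 𝓘(ℝ, E) f y (Y y)) x (X x)
        - mvfderiv 𝓘(ℝ, E) (fun y ↦ mvfderiv 𝓘(ℝ, E) f y (X y)) x (Y x) := by
  have key : ∀ {g : M → ℝ} (_ : ContMDiff 𝓘(ℝ, E) 𝓘(ℝ, ℝ) ∞ g) (U : VField E M)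
      {W : VField E M} (_ : IsSmoothField W), VectorField.mlieBracket 𝓘(ℝ, E) U (g • W) =
        (fun y ↦ mvfderiv 𝓘(ℝ, E) g y (U y)) • W + g • VectorField.mlieBracket 𝓘(ℝ, E) U W :=
    fun hg U W hW ↦ funext fun y ↦ VectorField.mlieBracket_smul_right
      ((hg y).mdifferentiableAt (by simp)) (hW.mdifferentiableAt y)
  have key2 : ∀ (U : VField E M) {W W' : VField E M} (_ : IsSmoothField W)
      (_ : IsSmoothField W'), VectorField.mlieBracket 𝓘(ℝ, E) U (W + W') =
        VectorField.mlieBracket 𝓘(ℝ, E) U W + VectorField.mlieBracket 𝓘(ℝ, E) U W' :=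
    fun U W W' hW hW' ↦ funext fun y ↦ VectorField.mlieBracket_add_right
      (hW.mdifferentiableAt y) (hW'.mdifferentiableAt y)
  have : IsManifold 𝓘(ℝ, E) (minSmoothness ℝ 3) M :=
    IsManifold.of_le (n := ∞) (by simp; exact ENat.LEInfty.out)
  have jac : ∀ {W : VField E M} (_ : IsSmoothField W), _ := fun {W} hW ↦
    VectorField.leibniz_identity_mlieBracket (I := 𝓘(ℝ, E)) (U := X) (V := Y) (W := W)
      (hX.of_le (by simp; exact ENat.LEInfty.out)) (hY.of_le (by simp; exact ENat.LEInfty.out))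
      (hW.of_le (by simp; exact ENat.LEInfty.out))
  have e1 := congr_fun (jac (hV.smul hf)) x
  have e2 := congr_fun (jac hV) x
  rw [key hf Y hV, key hf X hV, key hf _ hV, key2 X (hV.smul hYf) ((hY.mlieBracket hV).smul hf),
    key2 Y (hV.smul hXf) ((hX.mlieBracket hV).smul hf), key hYf X hV, key hXf Y hV,
    key hf X (hY.mlieBracket hV), key hf Y (hX.mlieBracket hV)] at e1
  simp only [Pi.add_apply, Pi.smul_apply'] at e1 e2
  rw [e2] at e1
  -- Modulo the Jacobi identity for `V`, the expansion for `f • V` leaves only the commutator defect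
  -- of `f` times `V x`.
  refine sub_eq_zero.1 ((smul_eq_zero.1 ?_).resolve_right hx)
  trans 0
  · rw [← sub_eq_zero.2 e1.symm]
    module
  · rfl

end Smooth

/-! ### The form π and its consequences when parallel -/

section ParallelField

variable {E : Type*} [NormedAddCommGroup E] [NormedSpace ℝ E]
  {M : Type*} [TopologicalSpace M] [ChartedSpace E M]
  [RiemannianBundle (fun x : M ↦ TangentSpace 𝓘(ℝ, E) x)] {ξ X Y Z W : VField E M}

/-- The function `π(Y)`. -/
noncomputable def assocFun (ξ Y : VField E M) (x : M) : ℝ :=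
  assocForm ξ x (Y x)

theorem assocFun_add (ξ Y Z : VField E M) : assocFun ξ (Y + Z) = assocFun ξ Y + assocFun ξ Z :=
  funext fun x ↦ map_add (assocForm ξ x) _ _

theorem assocFun_sub (ξ Y Z : VField E M) : assocFun ξ (Y - Z) = assocFun ξ Y - assocFun ξ Z :=
  funext fun x ↦ map_sub (assocForm ξ x) _ _

theorem assocFun_smul (ξ : VField E M) (f : M → ℝ) (Y : VField E M) :
    assocFun ξ (f • Y) = f * assocFun ξ Y :=
  funext fun x ↦ map_smul (assocForm ξ x) _ _

theorem assocFun_const_smul (ξ : VField E M) (c : ℝ) (Y : VField E M) :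
    assocFun ξ (c • Y) = c • assocFun ξ Y :=
  funext fun x ↦ map_smul (assocForm ξ x) _ _

theorem assocFun_self (hunit : ∀ x : M, inner ℝ (ξ x) (ξ x) = 1) : assocFun ξ ξ = 1 :=
  funext hunit

theorem ne_zero_of_assocFun_self (h : assocFun ξ ξ = 1) (x : M) : ξ x ≠ 0 := by
  intro h0
  have h1 : assocForm ξ x (ξ x) = 1 := congr_fun h x
  rw [h0, map_zero] at h1
  exact zero_ne_one h1

variable (E) in
/-- The coefficient `n / (n + 1)` of the `1`-form `ψ + φ` with respect to `π`. -/
noncomputable def projCoeff : ℝ :=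
  ((Module.finrank ℝ E : ℝ) - 1) / (2 * ((Module.finrank ℝ E : ℝ) + 1)) + 1 / 2

variable [IsManifold 𝓘(ℝ, E) ∞ M] {D : LinearConnection E M}

theorem covD_projSemiSymm_eq (D : LinearConnection E M) (ξ X Y : VField E M) :
    covD (projSemiSymm D ξ) X Y =
      covD D X Y + projCoeff E • assocFun ξ Y • X + (projCoeff E - 1) • assocFun ξ X • Y := by
  funext x
  rw [covD_projSemiSymm]
  simp only [phiForm, psiForm, smul_apply, smul_eq_mul, Pi.add_apply, Pi.smul_apply,
    Pi.smul_apply', assocFun, projCoeff]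
  module

theorem mvfderiv_assocFun (hpar : IsParallelForm D ξ) (hX : IsSmoothField X)
    (hY : IsSmoothField Y) :
    (fun x ↦ mvfderiv 𝓘(ℝ, E) (assocFun ξ Y) x (X x)) = assocFun ξ (covD D X Y) :=
  funext fun x ↦ sub_eq_zero.1 (hpar X Y hX hY x)

variable [IsContMDiffRiemannianBundle 𝓘(ℝ, E) ∞ E (fun x : M ↦ TangentSpace 𝓘(ℝ, E) x)]

theorem contMDiff_assocFun (hξ : IsSmoothField ξ) (hY : IsSmoothField Y) :
    ContMDiff 𝓘(ℝ, E) 𝓘(ℝ, ℝ) ∞ (assocFun ξ Y) :=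
  ContMDiff.inner_bundle (F := E) (E := fun x : M ↦ TangentSpace 𝓘(ℝ, E) x) hξ hY

theorem covD_assocFun_smul (hpar : IsParallelForm D ξ) (hξ : IsSmoothField ξ)
    (hX : IsSmoothField X) (hY : IsSmoothField Y) (hZ : IsSmoothField Z) :
    covD D X (assocFun ξ Y • Z) = assocFun ξ Y • covD D X Z + assocFun ξ (covD D X Y) • Z := by
  rw [covD_smul D X (contMDiff_assocFun hξ hY) hZ, mvfderiv_assocFun hpar hX hY]

variable [FiniteDimensional ℝ E]

theorem covD_eq_zero_of_isParallelForm (hD : IsLeviCivita D) (hpar : IsParallelForm D ξ)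
    (hξ : IsSmoothField ξ) (hX : IsSmoothField X) : covD D X ξ = 0 := by
  funext x
  -- Test field V = ∇_X ξ: metricity and parallelism both compute X(π(V)), and comparing them leaves
  -- |∇_X ξ|² = 0.
  have hV := hX.covD hD.smooth hξ
  have h1 := (isMetric_iff D).1 hD.metric (hX.mdifferentiableAt x) (hξ.mdifferentiableAt x)
    (hV.mdifferentiableAt x)
  have h2 := sub_eq_zero.1 (hpar X _ hX hV x)
  change _ = inner ℝ (ξ x) (covD D X (covD D X ξ) x) at h2
  exact inner_self_eq_zero.1 (right_eq_add.1 (h2.symm.trans h1))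

/-- Parallelism turns π(∇_X Z) into X(π(Z)), so π(R(X,Y)Z) is (XY - YX - [X,Y]) applied to the
function π(Z). The nowhere zero field needed for the commutator formula is ξ. -/
theorem assocFun_curvature (hD : IsLeviCivita D) (hpar : IsParallelForm D ξ)
    (hξ : IsSmoothField ξ) (hunit : assocFun ξ ξ = 1) (hX : IsSmoothField X)
    (hY : IsSmoothField Y) (hZ : IsSmoothField Z) : assocFun ξ (curvature D X Y Z) = 0 := by
  have : CompleteSpace E := FiniteDimensional.complete ℝ E
  funext x
  have h := mvfderiv_mlieBracket hX hY hξ (contMDiff_assocFun hξ hZ)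
    (by rw [mvfderiv_assocFun hpar hX hZ]; exact contMDiff_assocFun hξ (hX.covD hD.smooth hZ))
    (by rw [mvfderiv_assocFun hpar hY hZ]; exact contMDiff_assocFun hξ (hY.covD hD.smooth hZ))
    (ne_zero_of_assocFun_self hunit x)
  rw [mvfderiv_assocFun hpar hX hZ, mvfderiv_assocFun hpar hY hZ,
    congr_fun (mvfderiv_assocFun hpar (hX.mlieBracket hY) hZ) x,
    congr_fun (mvfderiv_assocFun hpar hX (hY.covD hD.smooth hZ)) x,
    congr_fun (mvfderiv_assocFun hpar hY (hX.covD hD.smooth hZ)) x] at h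
  simp only [curvature, assocFun_sub, Pi.sub_apply, Pi.zero_apply]
  rw [h, sub_self]

theorem curvature_parallel_eq_zero (hD : IsLeviCivita D) (hpar : IsParallelForm D ξ)
    (hξ : IsSmoothField ξ) (hX : IsSmoothField X) (hY : IsSmoothField Y) :
    curvature D X Y ξ = 0 := by
  have : CompleteSpace E := FiniteDimensional.complete ℝ E
  have h0 (U : VField E M) : covD D U 0 = 0 := by
    funext x
    exact congr($(D.isCovariantDerivativeOnUniv.zero) (U x))
  rw [curvature, covD_eq_zero_of_isParallelForm hD hpar hξ hX,
    covD_eq_zero_of_isParallelForm hD hpar hξ hY,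
    covD_eq_zero_of_isParallelForm hD hpar hξ (hX.mlieBracket hY), h0, h0, sub_zero, sub_zero]

theorem curvature_assocFun_smul (hD : IsLeviCivita D) (hpar : IsParallelForm D ξ)
    (hξ : IsSmoothField ξ) (hunit : assocFun ξ ξ = 1) (hX : IsSmoothField X)
    (hY : IsSmoothField Y) (hZ : IsSmoothField Z) (hW : IsSmoothField W) :
    curvature D X Y (assocFun ξ W • Z) = assocFun ξ W • curvature D X Y Z := by
  have : CompleteSpace E := FiniteDimensional.complete ℝ E
  have hs {U V : VField E M} (hU : IsSmoothField U) (hV : IsSmoothField V) :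
      IsSmoothField (assocFun ξ U • V) := hV.smul (contMDiff_assocFun hξ hU)
  have hc {U V : VField E M} (hU : IsSmoothField U) (hV : IsSmoothField V) :
      IsSmoothField (covD D U V) := hU.covD hD.smooth hV
  have h := assocFun_curvature hD hpar hξ hunit hX hY hW
  rw [curvature, assocFun_sub, assocFun_sub] at h
  rw [curvature, covD_assocFun_smul hpar hξ hY hW hZ, covD_assocFun_smul hpar hξ hX hW hZ,
    covD_assocFun_smul hpar hξ (hX.mlieBracket hY) hW hZ,
    covD_add D X (hs hW (hc hY hZ)) (hs (hc hY hW) hZ),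
    covD_add D Y (hs hW (hc hX hZ)) (hs (hc hX hW) hZ),
    covD_assocFun_smul hpar hξ hX hW (hc hY hZ), covD_assocFun_smul hpar hξ hX (hc hY hW) hZ,
    covD_assocFun_smul hpar hξ hY hW (hc hX hZ), covD_assocFun_smul hpar hξ hY (hc hX hW) hZ,
    curvature]
  -- In the Leibniz expansion the first-order terms cancel and the second-order ones add up to
  -- π(R(X,Y)W)Z = 0.
  have h' := congr($h • Z)
  rw [zero_smul] at h'
  rw [← sub_eq_zero, ← h']
  module

/-- If `π` is parallel, the curvatures of `∇̃` and `∇` differ by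
`(n / (n + 1))² π(Z)(π(Y)X - π(X)Y)`. -/
theorem curvature_projSemiSymm (hD : IsLeviCivita D) (hpar : IsParallelForm D ξ)
    (hξ : IsSmoothField ξ) (hX : IsSmoothField X) (hY : IsSmoothField Y) (hZ : IsSmoothField Z) :
    curvature (projSemiSymm D ξ) X Y Z = curvature D X Y Z +
      projCoeff E ^ 2 • assocFun ξ Z • (assocFun ξ Y • X - assocFun ξ X • Y) := by
  have : CompleteSpace E := FiniteDimensional.complete ℝ E
  have hs {U V : VField E M} (hU : IsSmoothField U) (hV : IsSmoothField V) :
      IsSmoothField (assocFun ξ U • V) := hV.smul (contMDiff_assocFun hξ hU)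
  have hc {U V : VField E M} (hU : IsSmoothField U) (hV : IsSmoothField V) :
      IsSmoothField (covD D U V) := hU.covD hD.smooth hV
  have hk {U : VField E M} (c : ℝ) (hU : IsSmoothField U) : IsSmoothField (c • U) :=
    hU.smul (f := fun _ ↦ c) contMDiff_const
  -- The factor 2c - 1 comes from π(∇̃_V Z) = π(∇_V Z) + (2c - 1)π(Z)π(V).
  have main {U V : VField E M} (hU : IsSmoothField U) (hV : IsSmoothField V) :
      covD (projSemiSymm D ξ) U (covD (projSemiSymm D ξ) V Z) =
        covD D U (covD D V Z)
        + projCoeff E • (assocFun ξ Z • covD D U V + assocFun ξ (covD D U Z) • V)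
        + (projCoeff E - 1) • (assocFun ξ V • covD D U Z + assocFun ξ (covD D U V) • Z)
        + projCoeff E • (assocFun ξ (covD D V Z)
            + (2 * projCoeff E - 1) • (assocFun ξ Z * assocFun ξ V)) • U
        + (projCoeff E - 1) • assocFun ξ U • (covD D V Z + projCoeff E • assocFun ξ Z • V
            + (projCoeff E - 1) • assocFun ξ V • Z) := by
    rw [covD_projSemiSymm_eq D ξ V Z, covD_projSemiSymm_eq D ξ U,
      covD_add D U ((hc hV hZ).add (hk _ (hs hZ hV))) (hk _ (hs hV hZ)),
      covD_add D U (hc hV hZ) (hk _ (hs hZ hV)), covD_const_smul D U _ (hs hZ hV),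
      covD_const_smul D U _ (hs hV hZ), covD_assocFun_smul hpar hξ hU hZ hV,
      covD_assocFun_smul hpar hξ hU hV hZ]
    simp only [assocFun_add, assocFun_const_smul, assocFun_smul]
    funext x
    simp only [Pi.add_apply, Pi.smul_apply, Pi.smul_apply', Pi.mul_apply, smul_eq_mul]
    module
  rw [curvature, main hX hY, main hY hX, covD_projSemiSymm_eq, curvature,
    mlieBracket_eq_covD_sub hD.torsionFree hX hY, assocFun_sub]
  funext x
  simp only [Pi.add_apply, Pi.sub_apply, Pi.smul_apply, Pi.smul_apply', Pi.mul_apply, smul_eq_mul]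
  module

/-! ### The two implications -/

theorem isSemiSymmetric_projSemiSymm_of_isFlat (hD : IsLeviCivita D) (hpar : IsParallelForm D ξ)
    (hξ : IsSmoothField ξ) (hflat : IsFlat D) : IsSemiSymmetric (projSemiSymm D ξ) := by
  intro X Y Z W U hX hY hZ hW hU
  have key {X Y Z : VField E M} (hX : IsSmoothField X) (hY : IsSmoothField Y)
      (hZ : IsSmoothField Z) : curvature (projSemiSymm D ξ) X Y Z =
      projCoeff E ^ 2 • assocFun ξ Z • (assocFun ξ Y • X - assocFun ξ X • Y) := by
    rw [curvature_projSemiSymm hD hpar hξ hX hY hZ, hflat X Y Z hX hY hZ, zero_add]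
  have hs {U V : VField E M} (hU : IsSmoothField U) (hV : IsSmoothField V) :
      IsSmoothField (assocFun ξ U • V) := hV.smul (contMDiff_assocFun hξ hU)
  have hsm {X Y Z : VField E M} (hX : IsSmoothField X) (hY : IsSmoothField Y)
      (hZ : IsSmoothField Z) : IsSmoothField (projCoeff E ^ 2 • assocFun ξ Z •
        (assocFun ξ Y • X - assocFun ξ X • Y)) :=
    .smul (f := fun _ ↦ projCoeff E ^ 2) contMDiff_const
      (((hs hY hX).sub (hs hX hY)).smul (contMDiff_assocFun hξ hZ))
  rw [curvatureAction, key hX hY hZ, key hX hY hW, key hX hY hU, key hZ hW hU,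
    key hX hY (hsm hZ hW hU), key (hsm hX hY hZ) hW hU, key hZ (hsm hX hY hW) hU,
    key hZ hW (hsm hX hY hU)]
  funext x
  simp only [assocFun_sub, assocFun_const_smul, assocFun_smul, Pi.sub_apply, Pi.smul_apply,
    Pi.smul_apply', Pi.mul_apply, smul_eq_mul, Pi.zero_apply]
  module

/-- On ξ only the B part of R̃ survives, so the first three terms of the action cancel, using
π(R̃(X,ξ)·) = 0. The last is R̃(Z,W) applied to c²(X - π(X)ξ); this vector is killed by π, and
R(Z,W)ξ = 0, leaving c²R(Z,W)X. -/
theorem curvatureAction_projSemiSymm_self (hD : IsLeviCivita D) (hpar : IsParallelForm D ξ)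
    (hξ : IsSmoothField ξ) (hunit : assocFun ξ ξ = 1) (hX : IsSmoothField X)
    (hZ : IsSmoothField Z) (hW : IsSmoothField W) :
    curvatureAction (projSemiSymm D ξ) X ξ Z W ξ = -(projCoeff E ^ 2 • curvature D Z W X) := by
  have : CompleteSpace E := FiniteDimensional.complete ℝ E
  have hs {U V : VField E M} (hU : IsSmoothField U) (hV : IsSmoothField V) :
      IsSmoothField (assocFun ξ U • V) := hV.smul (contMDiff_assocFun hξ hU)
  have hk {U : VField E M} (c : ℝ) (hU : IsSmoothField U) : IsSmoothField (c • U) :=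
    hU.smul (f := fun _ ↦ c) contMDiff_const
  have key {X Y Z : VField E M} (hX : IsSmoothField X) (hY : IsSmoothField Y)
      (hZ : IsSmoothField Z) := curvature_projSemiSymm hD hpar hξ hX hY hZ
  have par {X Y : VField E M} (hX : IsSmoothField X) (hY : IsSmoothField Y) :=
    curvature_parallel_eq_zero hD hpar hξ hX hY
  have sm {X Y Z : VField E M} (hX : IsSmoothField X) (hY : IsSmoothField Y)
      (hZ : IsSmoothField Z) : IsSmoothField (curvature D X Y Z) := hX.curvature hD.smooth hY hZ
  have hB {X Y : VField E M} (hX : IsSmoothField X) (hY : IsSmoothField Y) :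
      IsSmoothField (assocFun ξ Y • X - assocFun ξ X • Y) := (hs hY hX).sub (hs hX hY)
  have hV {U : VField E M} (hU : IsSmoothField U) : IsSmoothField (curvature D X ξ U +
      projCoeff E ^ 2 • assocFun ξ U • (assocFun ξ ξ • X - assocFun ξ X • ξ)) :=
    (sm hX hξ hU).add (hk _ ((hB hX hξ).smul (contMDiff_assocFun hξ hU)))
  have hξs {X Y : VField E M} (hX : IsSmoothField X) (hY : IsSmoothField Y) :
      curvature (projSemiSymm D ξ) X Y ξ =
        projCoeff E ^ 2 • (assocFun ξ Y • X - assocFun ξ X • Y) := by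
    rw [key hX hY hξ, par hX hY, hunit, one_smul, zero_add]
  rw [curvatureAction, hξs hZ hW, hξs hX hξ, key hX hξ hZ, key hX hξ hW, hξs (hV hZ) hW,
    hξs hZ (hV hW), key hX hξ (hk _ (hB hZ hW)), key hZ hW (hk _ (hB hX hξ)),
    curvature_const_smul hD.smooth hX hξ _ (hB hZ hW),
    curvature_const_smul hD.smooth hZ hW _ (hB hX hξ),
    curvature_sub hD.smooth hX hξ (hs hW hZ) (hs hZ hW),
    curvature_sub hD.smooth hZ hW (hs hξ hX) (hs hX hξ),
    curvature_assocFun_smul hD hpar hξ hunit hX hξ hZ hW,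
    curvature_assocFun_smul hD hpar hξ hunit hX hξ hW hZ,
    curvature_assocFun_smul hD hpar hξ hunit hZ hW hX hξ,
    curvature_assocFun_smul hD hpar hξ hunit hZ hW hξ hX, par hZ hW]
  funext x
  simp only [assocFun_sub, assocFun_add, assocFun_const_smul, assocFun_smul,
    assocFun_curvature hD hpar hξ hunit hX hξ hZ, assocFun_curvature hD hpar hξ hunit hX hξ hW,
    hunit, Pi.add_apply, Pi.sub_apply, Pi.neg_apply, Pi.smul_apply, Pi.smul_apply', Pi.mul_apply,
    smul_eq_mul, Pi.zero_apply, Pi.one_apply]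
  module

theorem isFlat_of_isSemiSymmetric_projSemiSymm (hn : 0 < Module.finrank ℝ E)
    (hD : IsLeviCivita D) (hpar : IsParallelForm D ξ) (hξ : IsSmoothField ξ)
    (hunit : assocFun ξ ξ = 1) (h : IsSemiSymmetric (projSemiSymm D ξ)) : IsFlat D := by
  intro Z W X hZ hW hX
  have h1 := h X ξ Z W ξ hX hξ hZ hW hξ
  rw [curvatureAction_projSemiSymm_self hD hpar hξ hunit hX hZ hW, neg_eq_zero] at h1
  -- The dimension enters only through c = n/(n+1) ≠ 0.
  refine (smul_eq_zero.1 h1).resolve_left (pow_ne_zero 2 ?_)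
  have hn' : (0 : ℝ) < Module.finrank ℝ E := mod_cast hn
  have : projCoeff E = Module.finrank ℝ E / (Module.finrank ℝ E + 1) := by
    rw [projCoeff]
    field_simp
    ring
  rw [this]
  positivity

end ParallelField

end ProjSemiSymm

theorem theorem4p2
    {E : Type*} [NormedAddCommGroup E] [NormedSpace ℝ E] [FiniteDimensional ℝ E]
    (hn : 2 < Module.finrank ℝ E)
    {M : Type*} [TopologicalSpace M] [T2Space M]
    [ChartedSpace E M] [IsManifold 𝓘(ℝ, E) ∞ M]
    [RiemannianBundle (fun x : M ↦ TangentSpace 𝓘(ℝ, E) x)]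
    [IsContMDiffRiemannianBundle 𝓘(ℝ, E) ∞ E (fun x : M ↦ TangentSpace 𝓘(ℝ, E) x)]
    (D : ProjSemiSymm.LinearConnection E M) (hD : ProjSemiSymm.IsLeviCivita D)
    (ξ : ProjSemiSymm.VField E M) (hξ : ProjSemiSymm.IsSmoothField ξ)
    (hunit : ∀ x : M, inner ℝ (ξ x) (ξ x) = 1)
    (hpar : ProjSemiSymm.IsParallelForm D ξ) :
    ProjSemiSymm.IsSemiSymmetric (ProjSemiSymm.projSemiSymm D ξ) ↔
      ProjSemiSymm.IsFlat D := by
  have hξξ := ProjSemiSymm.assocFun_self hunit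
  exact ⟨ProjSemiSymm.isFlat_of_isSemiSymmetric_projSemiSymm (by omega) hD hpar hξ hξξ,
    ProjSemiSymm.isSemiSymmetric_projSemiSymm_of_isFlat hD hpar hξ⟩
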